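/- For complex $a, q$ with $|q|<1$ put $(a;q)_\infty=\prod_{n=0}^{\infty}(1-aq^{n})$, and let $\left(\frac{\cdot}{3}\right)$ denote the Jacobi symbol modulo three. Sums over $d\mid m$ run over the positive divisors $d$ of $m$. Then for every complex $q$ with $|q|<1$ the following series converge and $$\sum_{n=0}^{\infty}\Bigl(\sum_{d\mid 3n+2} d\Bigr)q^{n}=\frac{3\,(q^{3};q^{3})_\infty^{6}}{(q;q)_\infty^{2}},$$ $$\sum_{n=0}^{\infty}\Bigl(\sum_{d\mid 3n+1}\left(\frac{d}{3}\right)\Bigr)q^{n}=\frac{(q^{3};q^{3})_\infty^{3}}{(q;q)_\infty},\qquad \sum_{n=0}^{\infty}\Bigl(\sum_{d\mid 3n+2}\left(\frac{d}{3}\right)\Bigr)q^{n}=0;$$ moreover $\sum_{d\mid 3n+2}\left(\frac{d}{3}\right)=0$ for every integer $n\ge 0$. -/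

import Mathlib

/-- The infinite `q`-Pochhammer symbol `(a; q)_∞ = ∏_{n ≥ 0} (1 - a q ^ n)`. -/
noncomputable def qPochhammerInf (a q : ℂ) : ℂ :=
  ∏' n : ℕ, (1 - a * q ^ n)

/-- The defining product of `(a; q)_∞` converges for `|q| < 1`. -/
theorem multipliable_qPochhammerInf (a : ℂ) {q : ℂ} (hq : ‖q‖ < 1) :
    Multipliable fun n : ℕ => 1 - a * q ^ n := by
  have h : Summable fun n : ℕ => ‖-(a * q ^ n)‖ := by
    simpa using (summable_geometric_of_lt_one (norm_nonneg q) hq).mul_left ‖a‖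
  simpa [sub_eq_add_neg] using multipliable_one_add_of_summable h

/-- The number `(q; q)_∞` is nonzero for `|q| < 1`, so one may divide by it. -/
theorem qPochhammerInf_self_ne_zero {q : ℂ} (hq : ‖q‖ < 1) : qPochhammerInf q q ≠ 0 := by
  have h : Summable fun n : ℕ => ‖-(q * q ^ n)‖ := by
    simpa using (summable_geometric_of_lt_one (norm_nonneg q) hq).mul_left ‖q‖
  have h1 := tprod_one_add_ne_zero_of_summable (f := fun n : ℕ => -(q * q ^ n)) (fun n hn => by
    have e : q ^ (n + 1) = 1 := by rw [pow_succ']; linear_combination -hn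
    have := pow_lt_one₀ (norm_nonneg q) hq (Nat.succ_ne_zero n)
    rw [← norm_pow, Nat.succ_eq_add_one, e] at this
    simp at this) h
  simpa [qPochhammerInf, sub_eq_add_neg] using h1

/-!
# Divisor sums over arithmetic progressions modulo three

Everything rests on the bilateral series `∑_{n ∈ ℤ} q ^ n / (1 - q ^ (3 n + 1))`.

Expanding its terms in geometric series gives the double series `∑ q ^ e` with
`3 e + 1 = (3 n + 1) (3 m + 1)`, minus the one with `3 e + 1 = (3 n + 2) (3 m + 2)`; collecting
equal exponents (`HasSum.divisorsAntidiagonal_of_prod`) turns the difference into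
`∑ (∑_{d ∣ 3 n + 1} (d / 3)) q ^ n`. Its product form is the case `a = x = q`, in base `q ^ 3`,
of Kronecker's formula
`∑_{n ∈ ℤ} x ^ n / (1 - a q ^ n) =
  (q)_∞ ^ 2 (a x)_∞ (q / (a x))_∞ / ((a)_∞ (q / a)_∞ (x)_∞ (q / x)_∞)`.
It is obtained as the limit of a finite partial fraction expansion, which is Lagrange
interpolation at the powers of `q` (`prod_sub_div_prod_sub_eq_sum`, `tsum_int_pow_div_eq`).

For the series with `∑_{d ∣ 3 n + 2} d`, the bilateral series is squared. In the double sum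
over `(n, m)`, the terms with a fixed `m - n ≠ 0` split into partial fractions, each a multiple of
a term of `∑_{n ∈ ℤ} q ^ (2 n) / (1 - q ^ (3 n + 1)) = 0` (`hasSum_int_sq_pow_div_zero`). Only the
diagonal `∑_{n ∈ ℤ} q ^ (2 n) / (1 - q ^ (3 n + 1)) ^ 2` is left (`sq_tsum_int_pow_div`), and this
is a third of `∑ (∑_{d ∣ 3 n + 2} d) q ^ n`, because in a factorization `3 n + 2 = d d'` one
factor is `1` and the other is `2` modulo three.
-/

open Filter Topology

theorem hasSum_of_eq {ι : Type*} {f g : ι → ℂ} {a b : ℂ} (h : HasSum f a) (hf : ∀ n, g n = f n)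
    (ha : b = a) : HasSum g b := by
  rwa [funext hf, ha]

/-! ### A finite partial fraction expansion -/

/-- The finite `q`-Pochhammer symbol `(a; q)_n = ∏_{i < n} (1 - a q ^ i)`. -/
noncomputable def qPochhammer (a q : ℂ) (n : ℕ) : ℂ :=
  ∏ i ∈ Finset.range n, (1 - a * q ^ i)

theorem qPochhammer_succ (a q : ℂ) (n : ℕ) :
    qPochhammer a q (n + 1) = qPochhammer a q n * (1 - a * q ^ n) :=
  Finset.prod_range_succ _ _

theorem qPochhammer_self_ne_zero {q : ℂ} (hq : ∀ n, q ^ (n + 1) ≠ 1) (n : ℕ) :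
    qPochhammer q q n ≠ 0 := by
  refine Finset.prod_ne_zero_iff.2 fun i _ h => hq i ?_
  rw [pow_succ']
  linear_combination -h

theorem zpow_ne_one {q : ℂ} (hq : ∀ n, q ^ (n + 1) ≠ 1) {k : ℤ} (hk : k ≠ 0) : q ^ k ≠ 1 := by
  intro h
  rcases lt_or_gt_of_ne hk with hk | hk
  · obtain ⟨n, rfl⟩ : ∃ n : ℕ, k = -((n + 1 : ℕ) : ℤ) := ⟨(-k - 1).toNat, by omega⟩
    rw [zpow_neg, inv_eq_one, zpow_natCast] at h
    exact hq n h
  · obtain ⟨n, rfl⟩ : ∃ n : ℕ, k = ((n + 1 : ℕ) : ℤ) := ⟨(k - 1).toNat, by omega⟩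
    rw [zpow_natCast] at h
    exact hq n h

/-- Together with `prod_Ico_pow_sub_mul_pow`, this evaluates `∏_{i < M} (X - x q ^ i)` at the node
`q ^ m`. The case `x = 1` is the part of the interpolation weight coming from earlier nodes. -/
theorem prod_range_pow_sub_mul_pow {x : ℂ} (hx : x ≠ 0) (q : ℂ) (m : ℕ) :
    ∏ i ∈ Finset.range m, (q ^ m - x * q ^ i) =
      (-x) ^ m * (∏ i ∈ Finset.range m, q ^ i) * qPochhammer (q / x) q m := by
  have h : qPochhammer (q / x) q m =
      ∏ i ∈ Finset.range m, (1 - q / x * q ^ (m - 1 - i)) := by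
    rw [Finset.prod_range_reflect (fun i => 1 - q / x * q ^ i) m]; rfl
  have hc : (-x) ^ m = ∏ _i ∈ Finset.range m, (-x) := by simp
  rw [h, hc, ← Finset.prod_mul_distrib, ← Finset.prod_mul_distrib]
  refine Finset.prod_congr rfl fun i hi => ?_
  have hi := Finset.mem_range.1 hi
  have e : q ^ m = q ^ i * (q * q ^ (m - 1 - i)) := by
    rw [← pow_succ', ← pow_add]; congr 1; omega
  rw [e]
  field_simp
  ring

theorem prod_Ico_pow_sub_mul_pow (x q : ℂ) (m n : ℕ) :
    ∏ i ∈ Finset.Ico m n, (q ^ m - x * q ^ i) = (q ^ m) ^ (n - m) * qPochhammer x q (n - m) := by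
  have hc : (q ^ m) ^ (n - m) = ∏ _i ∈ Finset.range (n - m), q ^ m := by simp
  rw [Finset.prod_Ico_eq_prod_range, hc, qPochhammer, ← Finset.prod_mul_distrib]
  refine Finset.prod_congr rfl fun i _ => ?_
  rw [pow_add]
  ring

/-- Lagrange interpolation of `∏_{i < M} (X - x q ^ i)` at the nodes `1, q, …, q ^ M`. -/
theorem prod_sub_div_prod_sub_eq_sum {q x z : ℂ} (hq0 : q ≠ 0) (hx : x ≠ 0)
    (hq : ∀ n, q ^ (n + 1) ≠ 1) (M : ℕ) (hz : ∀ m ≤ M, z ≠ q ^ m) :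
    (∏ i ∈ Finset.range M, (z - x * q ^ i)) / ∏ i ∈ Finset.range (M + 1), (z - q ^ i) =
      ∑ m ∈ Finset.range (M + 1), x ^ m / (z - q ^ m) *
        (qPochhammer x q (M - m) / qPochhammer q q (M - m)) *
        (qPochhammer (q / x) q m / qPochhammer q q m) := by
  classical
  set s := Finset.range (M + 1)
  set v : ℕ → ℂ := fun i => q ^ i
  have hlt : ∀ i j, i < j → q ^ i ≠ q ^ j := by
    intro i j hij h
    obtain ⟨k, rfl⟩ := Nat.exists_eq_add_of_lt hij
    rw [add_assoc, pow_add] at h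
    exact hq k (mul_left_cancel₀ (pow_ne_zero i hq0) (by rw [← h, mul_one]))
  have hv : Set.InjOn v s := by
    intro i _ j _ h
    by_contra hne
    rcases lt_or_gt_of_ne hne with h1 | h1
    · exact hlt i j h1 h
    · exact hlt j i h1 h.symm
  set p : Polynomial ℂ := ∏ i ∈ Finset.range M, (Polynomial.X - Polynomial.C (x * q ^ i))
  have hp : p.degree < s.card := by
    have : p.degree = (M : WithBot ℕ) := by
      simp only [p, Polynomial.degree_prod, Polynomial.degree_X_sub_C]
      simp
    rw [this, Finset.card_range]
    exact_mod_cast Nat.lt_succ_self M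
  have hpe : ∀ w, p.eval w = ∏ i ∈ Finset.range M, (w - x * q ^ i) := by
    intro w
    simp [p, Polynomial.eval_prod]
  have hzs : ∀ i ∈ s, z ≠ v i := fun i hi => hz i (Nat.lt_succ_iff.1 (Finset.mem_range.1 hi))
  have key := congrArg (Polynomial.eval z) (Lagrange.eq_interpolate hv hp)
  rw [Lagrange.eval_interpolate_not_at_node _ hzs, Lagrange.eval_nodal, hpe] at key
  have hne : ∏ i ∈ s, (z - v i) ≠ 0 :=
    Finset.prod_ne_zero_iff.2 fun i hi => sub_ne_zero.2 (hzs i hi)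
  rw [key, mul_div_cancel_left₀ _ hne]
  refine Finset.sum_congr rfl fun m hm => ?_
  have hmM : m ≤ M := Nat.lt_succ_iff.1 (Finset.mem_range.1 hm)
  have hnum : p.eval (v m) = (-x) ^ m * (∏ i ∈ Finset.range m, q ^ i) *
      qPochhammer (q / x) q m * ((q ^ m) ^ (M - m) * qPochhammer x q (M - m)) := by
    rw [hpe, ← Finset.prod_range_mul_prod_Ico _ hmM, prod_range_pow_sub_mul_pow hx,
      prod_Ico_pow_sub_mul_pow]
  have hden : ∏ j ∈ s.erase m, (v m - v j) = (-1) ^ m * (∏ i ∈ Finset.range m, q ^ i) *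
      qPochhammer q q m * ((q ^ m) ^ (M - m) * qPochhammer q q (M - m)) := by
    have hs : s.erase m = Finset.range m ∪ Finset.Ico (m + 1) (M + 1) := by
      ext j; simp [s]; omega
    have hd : Disjoint (Finset.range m) (Finset.Ico (m + 1) (M + 1)) := by
      rw [Finset.disjoint_left]; intro j; simp; omega
    rw [hs, Finset.prod_union hd]
    congr 1
    · simpa using prod_range_pow_sub_mul_pow one_ne_zero q m
    · have hc : (q ^ m) ^ (M - m) = ∏ _i ∈ Finset.range (M - m), q ^ m := by simp
      rw [Finset.prod_Ico_eq_prod_range, Nat.add_sub_add_right, hc, qPochhammer,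
        ← Finset.prod_mul_distrib]
      refine Finset.prod_congr rfl fun i _ => ?_
      simp only [v]
      ring
  have h1 := qPochhammer_self_ne_zero hq m
  have h2 := qPochhammer_self_ne_zero hq (M - m)
  have h3 : ∏ i ∈ Finset.range m, q ^ i ≠ 0 :=
    Finset.prod_ne_zero_iff.2 fun i _ => pow_ne_zero i hq0
  have h4 : z - q ^ m ≠ 0 := sub_ne_zero.2 (hzs m hm)
  rw [hnum, Lagrange.nodalWeight, Finset.prod_inv_distrib, hden, neg_pow x m]
  have h5 : ((-1 : ℂ)) ^ m ≠ 0 := pow_ne_zero _ (by norm_num)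
  simp only [v]
  field_simp

/-- The case `x = q` of the partial fraction expansion in base `q ^ 3`, taken at
`q ^ (3 N) / q`: there the product side collapses to a single factor. -/
theorem sum_range_div_eq {q : ℂ} (hq0 : q ≠ 0) (hq : ∀ n, q ^ (n + 1) ≠ 1) (N : ℕ) :
    ∑ m ∈ Finset.range (2 * N + 1),
      q ^ ((m : ℤ) - N) / (1 - q ^ (3 * ((m : ℤ) - N) + 1)) *
        (qPochhammer q (q ^ 3) (2 * N - m) / qPochhammer (q ^ 3) (q ^ 3) (2 * N - m)) *
        (qPochhammer (q ^ 2) (q ^ 3) m / qPochhammer (q ^ 3) (q ^ 3) m) =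
      1 / (1 - q ^ (3 * N + 1)) := by
  have hQ : ∀ n, (q ^ 3) ^ (n + 1) ≠ 1 := fun n h => by
    rw [← pow_mul] at h
    exact hq (3 * n + 2) (by rw [← h]; ring)
  have hz1 : ∀ k : ℤ, q ^ (3 * k + 1) ≠ 1 := fun k => zpow_ne_one hq (by omega)
  have hnode : ∀ m : ℕ, (q ^ 3) ^ N / q - (q ^ 3) ^ m =
      (q ^ 3) ^ N / q * (1 - q ^ (3 * ((m : ℤ) - N) + 1)) := by
    intro m
    rw [zpow_add₀ hq0, zpow_mul, zpow_sub₀ (zpow_ne_zero 3 hq0)]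
    norm_cast
    field_simp
  have hC : (q ^ 3) ^ N / q ≠ 0 := div_ne_zero (pow_ne_zero _ (pow_ne_zero _ hq0)) hq0
  have key := prod_sub_div_prod_sub_eq_sum (x := q) (z := (q ^ 3) ^ N / q)
    (pow_ne_zero 3 hq0) hq0 hQ (2 * N) (fun m _ => by
      rw [← sub_ne_zero, hnode]
      exact mul_ne_zero hC (sub_ne_zero.2 (hz1 _).symm))
  have h32 : q ^ 3 / q = q ^ 2 := by field_simp
  -- Up to signs and powers of `q`, the factors with `i < N` and `i ≥ N` give `(q; q³)_N` and
  -- `(q²; q³)_N` in the numerator, `(q²; q³)_N` and `(q; q³)_(N + 1)` in the denominator.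
  have hnum : ∏ i ∈ Finset.range (2 * N), ((q ^ 3) ^ N / q - q * (q ^ 3) ^ i) =
      ((-q) ^ N * (∏ i ∈ Finset.range N, (q ^ 3) ^ i) * qPochhammer q (q ^ 3) N) *
      (((q ^ 3) ^ N / q) ^ N * qPochhammer (q ^ 2) (q ^ 3) N) := by
    have := prod_range_pow_sub_mul_pow (pow_ne_zero 2 hq0) (q ^ 3) N
    have hA : ∏ i ∈ Finset.range N, ((q ^ 3) ^ N / q - q * (q ^ 3) ^ i) =
        (-q) ^ N * (∏ i ∈ Finset.range N, (q ^ 3) ^ i) * qPochhammer q (q ^ 3) N := by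
      have e : ∀ i, (q ^ 3) ^ N / q - q * (q ^ 3) ^ i =
        ((q ^ 3) ^ N - q ^ 2 * (q ^ 3) ^ i) / q := fun i => by field_simp
      have h31 : q ^ 3 / q ^ 2 = q := by field_simp
      simp only [e]
      rw [Finset.prod_div_distrib, this, h31, Finset.prod_const, Finset.card_range,
        neg_pow (q ^ 2), neg_pow q, ← pow_mul, mul_comm 2 N, pow_mul]
      field_simp
    have hB : ∏ i ∈ Finset.Ico N (2 * N), ((q ^ 3) ^ N / q - q * (q ^ 3) ^ i) =
        ((q ^ 3) ^ N / q) ^ N * qPochhammer (q ^ 2) (q ^ 3) N := by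
      have e : ∀ i, (q ^ 3) ^ N / q - q * (q ^ 3) ^ i =
        ((q ^ 3) ^ N - q ^ 2 * (q ^ 3) ^ i) / q := fun i => by field_simp
      have hn : 2 * N - N = N := by omega
      simp only [e]
      rw [Finset.prod_div_distrib, prod_Ico_pow_sub_mul_pow, Finset.prod_const, Nat.card_Ico, hn,
        div_pow]
      ring
    rw [← Finset.prod_range_mul_prod_Ico _ (show N ≤ 2 * N by omega), hA, hB]
  have hden : ∏ i ∈ Finset.range (2 * N + 1), ((q ^ 3) ^ N / q - (q ^ 3) ^ i) =
      ((-1) ^ N * (∏ i ∈ Finset.range N, (q ^ 3) ^ i) * qPochhammer (q ^ 2) (q ^ 3) N) *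
      (((q ^ 3) ^ N / q) ^ (N + 1) * qPochhammer q (q ^ 3) (N + 1)) := by
    have e : ∀ i, (q ^ 3) ^ N / q - (q ^ 3) ^ i = ((q ^ 3) ^ N - q * (q ^ 3) ^ i) / q :=
      fun i => by field_simp
    have hn : 2 * N + 1 - N = N + 1 := by omega
    simp only [e]
    rw [← Finset.prod_range_mul_prod_Ico _ (show N ≤ 2 * N + 1 by omega),
      Finset.prod_div_distrib, Finset.prod_div_distrib, prod_range_pow_sub_mul_pow hq0,
      prod_Ico_pow_sub_mul_pow, Finset.prod_const, Finset.prod_const, Nat.card_Ico, hn, h32,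
      div_pow, Finset.card_range, neg_pow q]
    field_simp
  have hne1 : qPochhammer q (q ^ 3) N ≠ 0 := by
    refine Finset.prod_ne_zero_iff.2 fun i _ h => hq (3 * i) ?_
    rw [pow_succ', pow_mul]
    linear_combination -h
  have hne2 : qPochhammer (q ^ 2) (q ^ 3) N ≠ 0 := by
    refine Finset.prod_ne_zero_iff.2 fun i _ h => hq (3 * i + 1) ?_
    rw [add_assoc, add_comm, pow_add, pow_mul]
    linear_combination -h
  have hne3 : ∏ i ∈ Finset.range N, (q ^ 3) ^ i ≠ 0 :=
    Finset.prod_ne_zero_iff.2 fun i _ => pow_ne_zero i (pow_ne_zero 3 hq0)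
  have hne4 : 1 - q ^ (3 * N + 1) ≠ 0 := sub_ne_zero.2 (hq (3 * N)).symm
  have hne5 : ((-1 : ℂ)) ^ N ≠ 0 := pow_ne_zero _ (by norm_num)
  have e5 : 1 - q * (q ^ 3) ^ N = 1 - q ^ (3 * N + 1) := by ring
  rw [hnum, hden, qPochhammer_succ, e5, neg_pow q, h32] at key
  set C := (q ^ 3) ^ N / q with hCdef
  have hlhs : ((-1) ^ N * q ^ N * (∏ i ∈ Finset.range N, (q ^ 3) ^ i) * qPochhammer q (q ^ 3) N) *
      (C ^ N * qPochhammer (q ^ 2) (q ^ 3) N) /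
      (((-1) ^ N * (∏ i ∈ Finset.range N, (q ^ 3) ^ i) * qPochhammer (q ^ 2) (q ^ 3) N) *
      (C ^ (N + 1) * (qPochhammer q (q ^ 3) N * (1 - q ^ (3 * N + 1))))) =
      q ^ N / C * (1 / (1 - q ^ (3 * N + 1))) := by
    rw [pow_succ C]
    field_simp
  rw [hlhs] at key
  have hqC : q ^ N / C ≠ 0 := div_ne_zero (pow_ne_zero _ hq0) hC
  apply mul_left_cancel₀ hqC
  rw [key, Finset.mul_sum]
  refine Finset.sum_congr rfl fun m _ => ?_
  rw [hnode, zpow_sub₀ hq0]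
  have h7 : 1 - q ^ (3 * ((m : ℤ) - N) + 1) ≠ 0 := sub_ne_zero.2 (hz1 _).symm
  rw [zpow_natCast, zpow_natCast]
  field_simp

/-! ### Bilateral series -/

theorem pow_succ_ne_one {q : ℂ} (hq : ‖q‖ < 1) (n : ℕ) : q ^ (n + 1) ≠ 1 := by
  intro h
  have := pow_lt_one₀ (norm_nonneg q) hq n.succ_ne_zero
  rw [← norm_pow, Nat.succ_eq_add_one, h] at this
  simp at this

theorem summable_natProd_mul_pow {q : ℂ} (hq : ‖q‖ < 1) {w : ℕ × ℕ → ℂ} {e : ℕ × ℕ → ℕ}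
    (hw : ∀ p, ‖w p‖ ≤ (p.1 + 1) * (p.2 + 1)) (he : ∀ p, p.1 + p.2 ≤ e p) :
    Summable fun p => w p * q ^ e p := by
  have h1 : Summable fun n : ℕ => ((n : ℝ) + 1) * ‖q‖ ^ n := by
    have hn : ‖‖q‖‖ < 1 := by simpa using hq
    have a := (hasSum_coe_mul_geometric_of_norm_lt_one hn).summable
    have b := summable_geometric_of_norm_lt_one hn
    simpa [add_mul] using a.add b
  have h2 := h1.mul_of_nonneg h1 (fun n => by positivity) (fun n => by positivity)
  refine Summable.of_norm_bounded h2 fun p => ?_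
  rw [norm_mul, norm_pow]
  calc ‖w p‖ * ‖q‖ ^ e p ≤ ((p.1 + 1) * (p.2 + 1)) * ‖q‖ ^ (p.1 + p.2) :=
        mul_le_mul (hw p) (pow_le_pow_of_le_one (norm_nonneg q) hq.le (he p))
          (by positivity) (by positivity)
    _ = _ := by rw [pow_add]; ring

theorem hasSum_succ_mul_geometric {y : ℂ} (hy : ‖y‖ < 1) :
    HasSum (fun m : ℕ => ((m : ℂ) + 1) * y ^ m) (1 / (1 - y) ^ 2) := by
  have hne : 1 - y ≠ 0 := sub_ne_zero.2 fun h => by simp [← h] at hy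
  have h := (hasSum_coe_mul_geometric_of_norm_lt_one hy).add (hasSum_geometric_of_norm_lt_one hy)
  have e : y / (1 - y) ^ 2 + (1 - y)⁻¹ = 1 / (1 - y) ^ 2 := by field_simp; ring
  rw [e] at h
  simpa [add_mul] using h

theorem norm_pow_succ_lt_one {q : ℂ} (hq : ‖q‖ < 1) (n : ℕ) : ‖q ^ (n + 1)‖ < 1 := by
  rw [norm_pow]
  exact pow_lt_one₀ (norm_nonneg q) hq n.succ_ne_zero

/-- Both halves of `∑_{n ∈ ℤ} q ^ n / (1 - q ^ (3 n + 1))`, expanded in geometric series. -/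
theorem hasSum_int_pow_div {q : ℂ} (hq : ‖q‖ < 1) (hq0 : q ≠ 0) :
    HasSum (fun n : ℤ => q ^ n / (1 - q ^ (3 * n + 1)))
      ((∑' p : ℕ × ℕ, q ^ (3 * p.1 * p.2 + p.1 + p.2)) -
        ∑' p : ℕ × ℕ, q ^ (3 * p.1 * p.2 + 2 * p.1 + 2 * p.2 + 1)) := by
  have s1 : Summable fun p : ℕ × ℕ => q ^ (3 * p.1 * p.2 + p.1 + p.2) := by
    simpa using summable_natProd_mul_pow hq (w := fun _ => 1) (fun p => by
      simp only [norm_one]; nlinarith [p.1.cast_nonneg (α := ℝ), p.2.cast_nonneg (α := ℝ)])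
      (e := fun p => 3 * p.1 * p.2 + p.1 + p.2) (fun p => by omega)
  have s2 : Summable fun p : ℕ × ℕ => q ^ (3 * p.1 * p.2 + 2 * p.1 + 2 * p.2 + 1) := by
    simpa using summable_natProd_mul_pow hq (w := fun _ => 1) (fun p => by
      simp only [norm_one]; nlinarith [p.1.cast_nonneg (α := ℝ), p.2.cast_nonneg (α := ℝ)])
      (e := fun p => 3 * p.1 * p.2 + 2 * p.1 + 2 * p.2 + 1) (fun p => by omega)
  rw [sub_eq_add_neg]
  refine HasSum.of_nat_of_neg_add_one ?_ ?_
  · refine s1.hasSum.prod_fiberwise fun n => ?_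
    have h := (hasSum_geometric_of_norm_lt_one
      (norm_pow_succ_lt_one hq (3 * n))).mul_left (q ^ n)
    refine hasSum_of_eq h (fun m => ?_) ?_
    · dsimp only
      rw [← pow_mul, ← pow_add]
      ring_nf
    · rw [div_eq_mul_inv]
      norm_cast
  · refine s2.hasSum.neg.prod_fiberwise fun n => ?_
    have h := ((hasSum_geometric_of_norm_lt_one
      (norm_pow_succ_lt_one hq (3 * n + 1))).mul_left (q ^ (2 * n + 1))).neg
    refine hasSum_of_eq h (fun m => ?_) ?_
    · dsimp only
      rw [← pow_mul, ← pow_add]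
      ring_nf
    · have hne : 1 - q ^ (3 * n + 1 + 1) ≠ 0 := sub_ne_zero.2 (pow_succ_ne_one hq _).symm
      have e1 : q ^ (-((n : ℤ) + 1)) = (q ^ (n + 1))⁻¹ := by
        rw [zpow_neg]; norm_cast
      have e2 : q ^ (3 * (-((n : ℤ) + 1)) + 1) = (q ^ (3 * n + 1 + 1))⁻¹ := by
        rw [← zpow_natCast q (3 * n + 1 + 1), ← zpow_neg]; congr 1
      have e3 : q ^ (3 * n + 1 + 1) = q ^ (2 * n + 1) * q ^ (n + 1) := by ring
      rw [e1, e2]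
      have h4 : 1 - (q ^ (3 * n + 1 + 1))⁻¹ = -(1 - q ^ (3 * n + 1 + 1)) /
          (q ^ (2 * n + 1) * q ^ (n + 1)) := by rw [← e3]; field_simp; ring
      rw [h4]
      field_simp

/-- The two halves of this bilateral series are the same double series, up to sign and the
interchange of the two indices. -/
theorem hasSum_int_sq_pow_div_zero {q : ℂ} (hq : ‖q‖ < 1) (hq0 : q ≠ 0) :
    HasSum (fun n : ℤ => q ^ (2 * n) / (1 - q ^ (3 * n + 1))) 0 := by
  have s1 : Summable fun p : ℕ × ℕ => q ^ (3 * p.1 * p.2 + 2 * p.1 + p.2) := by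
    simpa using summable_natProd_mul_pow hq (w := fun _ => 1) (fun p => by
      simp only [norm_one]; nlinarith [p.1.cast_nonneg (α := ℝ), p.2.cast_nonneg (α := ℝ)])
      (e := fun p => 3 * p.1 * p.2 + 2 * p.1 + p.2) (fun p => by omega)
  have s2 := (Equiv.prodComm ℕ ℕ).hasSum_iff.2 s1.hasSum
  rw [← add_neg_cancel (∑' p : ℕ × ℕ, q ^ (3 * p.1 * p.2 + 2 * p.1 + p.2))]
  refine HasSum.of_nat_of_neg_add_one ?_ ?_
  · refine s1.hasSum.prod_fiberwise fun n => ?_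
    have h := (hasSum_geometric_of_norm_lt_one
      (norm_pow_succ_lt_one hq (3 * n))).mul_left (q ^ (2 * n))
    refine hasSum_of_eq h (fun m => ?_) ?_
    · dsimp only
      rw [← pow_mul, ← pow_add]
      ring_nf
    · rw [div_eq_mul_inv]
      norm_cast
  · refine s2.neg.prod_fiberwise fun n => ?_
    have h := ((hasSum_geometric_of_norm_lt_one
      (norm_pow_succ_lt_one hq (3 * n + 1))).mul_left (q ^ n)).neg
    refine hasSum_of_eq h (fun m => ?_) ?_
    · simp only [Function.comp, Equiv.prodComm_apply, Prod.swap]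
      rw [← pow_mul, ← pow_add]
      ring_nf
    · have hne : 1 - q ^ (3 * n + 1 + 1) ≠ 0 := sub_ne_zero.2 (pow_succ_ne_one hq _).symm
      have e1 : q ^ (2 * -((n : ℤ) + 1)) = (q ^ (2 * n + 2))⁻¹ := by
        rw [← zpow_natCast q (2 * n + 2), ← zpow_neg]; congr 1
      have e2 : q ^ (3 * (-((n : ℤ) + 1)) + 1) = (q ^ (3 * n + 1 + 1))⁻¹ := by
        rw [← zpow_natCast q (3 * n + 1 + 1), ← zpow_neg]; congr 1
      have e3 : q ^ (3 * n + 1 + 1) = q ^ n * q ^ (2 * n + 2) := by ring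
      rw [e1, e2]
      have h4 : 1 - (q ^ (3 * n + 1 + 1))⁻¹ = -(1 - q ^ (3 * n + 1 + 1)) /
          (q ^ n * q ^ (2 * n + 2)) := by rw [← e3]; field_simp; ring
      rw [h4]
      field_simp

/-- The expansion of `∑_{n ∈ ℤ} q ^ (2 n) / (1 - q ^ (3 n + 1)) ^ 2` as a double series; the
negative half contributes the summand `p.1` of the weight. -/
theorem hasSum_int_sq_pow_div_sq {q : ℂ} (hq : ‖q‖ < 1) (hq0 : q ≠ 0) :
    HasSum (fun n : ℤ => q ^ (2 * n) / (1 - q ^ (3 * n + 1)) ^ 2)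
      (∑' p : ℕ × ℕ, ((p.1 : ℂ) + p.2 + 1) * q ^ (3 * p.1 * p.2 + 2 * p.1 + p.2)) := by
  have s1 : Summable fun p : ℕ × ℕ => ((p.2 : ℂ) + 1) * q ^ (3 * p.1 * p.2 + 2 * p.1 + p.2) :=
    summable_natProd_mul_pow hq (w := fun p => (p.2 : ℂ) + 1) (fun p => by
      refine (norm_add_le _ _).trans ?_
      simp only [norm_one, Complex.norm_natCast]
      nlinarith [p.1.cast_nonneg (α := ℝ), p.2.cast_nonneg (α := ℝ),
        mul_nonneg (p.1.cast_nonneg (α := ℝ)) (p.2.cast_nonneg (α := ℝ))])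
      (e := fun p => 3 * p.1 * p.2 + 2 * p.1 + p.2) (fun p => by omega)
  have s2 : Summable fun p : ℕ × ℕ => (p.1 : ℂ) * q ^ (3 * p.1 * p.2 + 2 * p.1 + p.2) :=
    summable_natProd_mul_pow hq (w := fun p => (p.1 : ℂ)) (fun p => by
      simp only [Complex.norm_natCast]
      nlinarith [p.1.cast_nonneg (α := ℝ), p.2.cast_nonneg (α := ℝ),
        mul_nonneg (p.1.cast_nonneg (α := ℝ)) (p.2.cast_nonneg (α := ℝ))])
      (e := fun p => 3 * p.1 * p.2 + 2 * p.1 + p.2) (fun p => by omega)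
  have hadd := s1.tsum_add s2
  have e0 : (∑' p : ℕ × ℕ, ((p.1 : ℂ) + p.2 + 1) * q ^ (3 * p.1 * p.2 + 2 * p.1 + p.2)) =
      (∑' p : ℕ × ℕ, ((p.2 : ℂ) + 1) * q ^ (3 * p.1 * p.2 + 2 * p.1 + p.2)) +
      ∑' p : ℕ × ℕ, (p.1 : ℂ) * q ^ (3 * p.1 * p.2 + 2 * p.1 + p.2) := by
    rw [← hadd]
    exact tsum_congr fun p => by ring
  rw [e0]
  refine HasSum.of_nat_of_neg_add_one ?_ ?_
  · refine s1.hasSum.prod_fiberwise fun n => ?_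
    have h := (hasSum_succ_mul_geometric
      (norm_pow_succ_lt_one hq (3 * n))).mul_left (q ^ (2 * n))
    refine hasSum_of_eq h (fun m => ?_) ?_
    · dsimp only
      rw [← pow_mul, mul_left_comm, ← pow_add]
      ring_nf
    · rw [mul_one_div]
      norm_cast
  · refine ((Equiv.prodComm ℕ ℕ).hasSum_iff.2 s2.hasSum).prod_fiberwise fun n => ?_
    have h := (hasSum_coe_mul_geometric_of_norm_lt_one
      (norm_pow_succ_lt_one hq (3 * n + 1))).mul_left (q ^ n)
    refine hasSum_of_eq h (fun m => ?_) ?_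
    · simp only [Function.comp, Equiv.prodComm_apply, Prod.swap]
      rw [← pow_mul, mul_left_comm, ← pow_add]
      ring_nf
    · have hne : 1 - q ^ (3 * n + 1 + 1) ≠ 0 := sub_ne_zero.2 (pow_succ_ne_one hq _).symm
      have e1 : q ^ (2 * -((n : ℤ) + 1)) = (q ^ (2 * n + 2))⁻¹ := by
        rw [← zpow_natCast q (2 * n + 2), ← zpow_neg]; congr 1
      have e2 : q ^ (3 * (-((n : ℤ) + 1)) + 1) = (q ^ (3 * n + 1 + 1))⁻¹ := by
        rw [← zpow_natCast q (3 * n + 1 + 1), ← zpow_neg]; congr 1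
      have h4 : 1 - (q ^ (3 * n + 1 + 1))⁻¹ = -(1 - q ^ (3 * n + 1 + 1)) /
          q ^ (3 * n + 1 + 1) := by
        field_simp
        ring
      have e3 : q ^ (3 * n + 1 + 1) = q ^ n * q ^ (2 * n + 2) := by ring
      rw [e1, e2, h4, div_pow, neg_sq]
      rw [e3] at hne ⊢
      field_simp

/-- For `n ≠ m` the product of the `n`-th and `m`-th terms splits into partial fractions. -/
theorem div_mul_div_eq_of_ne {q : ℂ} (hq : ‖q‖ < 1) (hq0 : q ≠ 0) (n : ℤ) {k : ℤ} (hk : k ≠ 0) :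
    q ^ n / (1 - q ^ (3 * n + 1)) * (q ^ (n + k) / (1 - q ^ (3 * (n + k) + 1))) =
      q ^ k / (1 - q ^ (3 * k)) * (q ^ (2 * n) / (1 - q ^ (3 * n + 1))) +
      q ^ (-k) / (1 - q ^ (3 * -k)) * (q ^ (2 * (n + k)) / (1 - q ^ (3 * (n + k) + 1))) := by
  have hz := fun j (hj : j ≠ 0) => sub_ne_zero.2 (zpow_ne_one (pow_succ_ne_one hq) (k := j) hj).symm
  have h1 := hz (3 * n + 1) (by omega)
  have h2 := hz (3 * (n + k) + 1) (by omega)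
  have h3 := hz (3 * k) (by omega)
  have en : q ^ n ≠ 0 := zpow_ne_zero _ hq0
  have ek : q ^ k ≠ 0 := zpow_ne_zero _ hq0
  have e1 : q ^ (3 * n + 1) = (q ^ n) ^ 3 * q := by
    rw [zpow_add₀ hq0, mul_comm 3 n, zpow_mul]; norm_cast; simp
  have e2 : q ^ (3 * (n + k) + 1) = (q ^ n) ^ 3 * (q ^ k) ^ 3 * q := by
    rw [zpow_add₀ hq0, mul_comm 3 (n + k), zpow_mul, zpow_add₀ hq0, ← mul_pow]; norm_cast; simp
  have e3 : q ^ (3 * k) = (q ^ k) ^ 3 := by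
    rw [mul_comm 3 k, zpow_mul]; norm_cast
  have e4 : 1 - q ^ (3 * -k) = -(1 - (q ^ k) ^ 3) / (q ^ k) ^ 3 := by
    rw [mul_comm 3 (-k), zpow_mul, zpow_neg]
    norm_cast
    field_simp
    ring
  have e5 : q ^ (2 * n) = (q ^ n) ^ 2 := by
    rw [mul_comm 2 n, zpow_mul]; norm_cast
  have e6 : q ^ (2 * (n + k)) = (q ^ n * q ^ k) ^ 2 := by
    rw [mul_comm 2 (n + k), zpow_mul, zpow_add₀ hq0]; norm_cast
  rw [e1] at h1
  rw [e2] at h2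
  rw [e3] at h3
  rw [e1, e2, e3, e4, e5, e6, zpow_neg, zpow_add₀ hq0]
  generalize q ^ n = x at *
  generalize q ^ k = y at *
  obtain ⟨B, hB⟩ : ∃ B, B = 1 - x ^ 3 * y ^ 3 * q := ⟨_, rfl⟩
  rw [← hB] at h2 ⊢
  field_simp
  rw [hB]
  ring

/-- The off-diagonal terms of the square cancel along each line `m - n = k`. -/
theorem sq_tsum_int_pow_div {q : ℂ} (hq : ‖q‖ < 1) (hq0 : q ≠ 0) :
    (∑' n : ℤ, q ^ n / (1 - q ^ (3 * n + 1))) ^ 2 =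
      ∑' n : ℤ, q ^ (2 * n) / (1 - q ^ (3 * n + 1)) ^ 2 := by
  have hg := (hasSum_int_pow_div hq hq0).summable
  have hH := hasSum_int_sq_pow_div_zero hq hq0
  have hK := (hasSum_int_sq_pow_div_sq hq hq0).summable.hasSum
  set T := ∑' n : ℤ, q ^ (2 * n) / (1 - q ^ (3 * n + 1)) ^ 2
  have hsplit := fun n k hk => div_mul_div_eq_of_ne hq hq0 n (k := k) hk
  set g : ℤ → ℂ := fun n => q ^ n / (1 - q ^ (3 * n + 1)) with hgdef
  have hsum : Summable fun p : ℤ × ℤ => g p.1 * g p.2 :=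
    summable_mul_of_summable_norm hg.norm hg.norm
  have hsq : HasSum (fun p : ℤ × ℤ => g p.1 * g p.2) ((∑' n, g n) * ∑' n, g n) :=
    hg.hasSum.mul hg.hasSum hsum
  -- Order the pairs `(n, m)` by the difference `k = m - n`.
  let e : ℤ × ℤ ≃ ℤ × ℤ :=
    { toFun := fun p => (p.2, p.2 + p.1)
      invFun := fun p => (p.2 - p.1, p.1)
      left_inv := fun p => by simp
      right_inv := fun p => by simp }
  have hsq' : HasSum (fun p : ℤ × ℤ => g p.2 * g (p.2 + p.1)) ((∑' n, g n) * ∑' n, g n) :=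
    e.hasSum_iff.2 hsq
  have hin : ∀ k : ℤ, HasSum (fun n => g n * g (n + k)) (if k = 0 then T else 0) := by
    intro k
    split_ifs with hk
    · subst hk
      have e1 : (fun n => g n * g (n + 0)) =
          fun n : ℤ => q ^ (2 * n) / (1 - q ^ (3 * n + 1)) ^ 2 := by
        funext n
        rw [add_zero, ← sq, hgdef, div_pow, mul_comm 2 n, zpow_mul]
        norm_cast
      rwa [e1]
    · have e1 := fun n => hsplit n k hk
      rw [show (fun n => g n * g (n + k)) = _ from funext e1]
      have hH' := (Equiv.addRight k).hasSum_iff.2 hH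
      simpa using (hH.mul_left (q ^ k / (1 - q ^ (3 * k)))).add
        (hH'.mul_left (q ^ (-k) / (1 - q ^ (3 * -k))))
  have h := hsq'.prod_fiberwise hin
  rw [sq]
  exact h.unique (hasSum_ite_eq (0 : ℤ) T)

/-! ### Divisor sums modulo three -/

/-- Collecting a double series over `(n, m)` by the value of the product
`(3 n + i) (3 m + j) = 3 N + r` turns it into a power series whose coefficients are sums over
factorizations of `3 N + r`. -/
theorem HasSum.divisorsAntidiagonal_of_prod {q S : ℂ} {i j r c : ℕ} (hi : 0 < i) (hi3 : i < 3)
    (hj : 0 < j) (hj3 : j < 3) (hr : 3 * c + r = i * j) (hr0 : 0 < r) {f : ℕ → ℕ → ℂ}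
    (h : HasSum (fun p : ℕ × ℕ => f (3 * p.1 + i) (3 * p.2 + j) *
      q ^ (3 * p.1 * p.2 + j * p.1 + i * p.2 + c)) S) :
    HasSum (fun n : ℕ => (∑ x ∈ (3 * n + r).divisorsAntidiagonal with x.1 % 3 = i,
      f x.1 x.2) * q ^ n) S := by
  let e : ℕ × ℕ → ℕ := fun p => 3 * p.1 * p.2 + j * p.1 + i * p.2 + c
  have he : ∀ p, (3 * p.1 + i) * (3 * p.2 + j) = 3 * e p + r := fun p => by
    simp only [e]
    linear_combination -hr
  refine ((Equiv.sigmaFiberEquiv e).hasSum_iff.2 h).sigma fun n => ?_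
  -- The first factor determines the residue of the second.
  have hmod : ∀ a b, a * b = 3 * n + r → a % 3 = i → b % 3 = j := by
    intro a b hab ha
    have h1 : (a % 3) * (b % 3) % 3 = r % 3 := by rw [← Nat.mul_mod, hab]; omega
    have hb : b % 3 < 3 := Nat.mod_lt _ (by norm_num)
    rw [ha] at h1
    generalize b % 3 = k at *
    interval_cases i <;> interval_cases j <;> interval_cases k <;> omega
  let ψ : {p // e p = n} ≃
      {x // x ∈ (3 * n + r).divisorsAntidiagonal.filter fun x => x.1 % 3 = i} :=
    { toFun := fun p => ⟨(3 * p.1.1 + i, 3 * p.1.2 + j), by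
        rw [Finset.mem_filter, Nat.mem_divisorsAntidiagonal]
        refine ⟨⟨by rw [he, p.2], by omega⟩, ?_⟩
        dsimp only
        omega⟩
      invFun := fun x => ⟨(x.1.1 / 3, x.1.2 / 3), by
        obtain ⟨⟨a, b⟩, hx⟩ := x
        rw [Finset.mem_filter, Nat.mem_divisorsAntidiagonal] at hx
        have h1 := hx.2
        have h2 := hmod a b hx.1.1 h1
        have h3 := he (a / 3, b / 3)
        have h4 : 3 * (a / 3) + i = a := by dsimp only at h1; omega
        have h5 : 3 * (b / 3) + j = b := by omega
        dsimp only at h3 hx ⊢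
        rw [h4, h5, hx.1.1] at h3
        omega⟩
      left_inv := fun p => by
        obtain ⟨⟨a, b⟩, hp⟩ := p
        simp only [Subtype.mk.injEq, Prod.mk.injEq]
        omega
      right_inv := fun x => by
        obtain ⟨⟨a, b⟩, hx⟩ := x
        rw [Finset.mem_filter, Nat.mem_divisorsAntidiagonal] at hx
        have h1 := hx.2
        have h2 := hmod a b hx.1.1 h1
        dsimp only at h1
        simp only [Subtype.mk.injEq, Prod.mk.injEq]
        omega }
  rw [Finset.sum_mul]
  have hT := Finset.hasSum ((3 * n + r).divisorsAntidiagonal.filter fun x => x.1 % 3 = i)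
    fun x => f x.1 x.2 * q ^ n
  have hfg : ((fun p : ℕ × ℕ => f (3 * p.1 + i) (3 * p.2 + j) *
      q ^ (3 * p.1 * p.2 + j * p.1 + i * p.2 + c)) ∘ Equiv.sigmaFiberEquiv e) ∘ Sigma.mk n =
      ((fun x : ℕ × ℕ => f x.1 x.2 * q ^ n) ∘ Subtype.val) ∘ ψ := by
    funext p
    have hp : 3 * p.1.1 * p.1.2 + j * p.1.1 + i * p.1.2 + c = n := p.2
    simp only [Function.comp, Equiv.sigmaFiberEquiv, Equiv.coe_fn_mk, ψ, hp]
  have hψ := ψ.hasSum_iff.2 hT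
  exact hasSum_of_eq hψ (congrFun hfg) rfl

theorem jacobiSym_three_of_mod_eq_one {d : ℕ} (h : d % 3 = 1) : jacobiSym (d : ℤ) 3 = 1 := by
  rw [jacobiSym.mod_left, show ((d : ℤ) % (3 : ℕ)) = 1 by omega]
  norm_num

theorem jacobiSym_three_of_mod_eq_two {d : ℕ} (h : d % 3 = 2) : jacobiSym (d : ℤ) 3 = -1 := by
  rw [jacobiSym.mod_left, show ((d : ℤ) % (3 : ℕ)) = 2 by omega]
  norm_num

/-- The divisor sum changes sign under `d ↦ (3 n + 2) / d`. -/
theorem sum_divisors_jacobiSym_three_eq_zero (n : ℕ) :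
    ∑ d ∈ (3 * n + 2).divisors, jacobiSym (d : ℤ) 3 = 0 := by
  have h : ∑ d ∈ (3 * n + 2).divisors, jacobiSym (d : ℤ) 3 =
      -∑ d ∈ (3 * n + 2).divisors, jacobiSym (d : ℤ) 3 := by
    rw [← Finset.sum_neg_distrib]
    conv_lhs => rw [← Nat.sum_div_divisors]
    refine Finset.sum_congr rfl fun d hd => ?_
    have hmul : d * ((3 * n + 2) / d) = 3 * n + 2 :=
      Nat.mul_div_cancel' (Nat.dvd_of_mem_divisors hd)
    have h1 : jacobiSym (d : ℤ) 3 * jacobiSym (((3 * n + 2) / d : ℕ) : ℤ) 3 = -1 := by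
      rw [← jacobiSym.mul_left, ← Nat.cast_mul, hmul]
      exact jacobiSym_three_of_mod_eq_two (by omega)
    rcases Int.mul_eq_neg_one_iff_eq_one_or_neg_one.1 h1 with ⟨h2, h3⟩ | ⟨h2, h3⟩ <;> rw [h2, h3]
    rfl
  omega

theorem sum_filter_add_eq_sum_divisors (n : ℕ) :
    ∑ x ∈ (3 * n + 2).divisorsAntidiagonal with x.1 % 3 = 1, ((x.1 : ℂ) + x.2) =
      ∑ d ∈ (3 * n + 2).divisors, (d : ℂ) := by
  set A := (3 * n + 2).divisorsAntidiagonal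
  -- Exactly one of the two factors of `3 n + 2` is `1` modulo three.
  have hswap : ∑ x ∈ A with x.1 % 3 = 1, (x.2 : ℂ) = ∑ x ∈ A with ¬ x.1 % 3 = 1, (x.1 : ℂ) := by
    refine Finset.sum_nbij' Prod.swap Prod.swap ?_ ?_ (by simp) (by simp) (by simp)
    all_goals
      rintro ⟨a, b⟩ hx
      rw [Finset.mem_filter, Nat.mem_divisorsAntidiagonal] at hx ⊢
      obtain ⟨⟨hab, -⟩, ha⟩ := hx
      refine ⟨⟨by rw [Prod.fst_swap, Prod.snd_swap, mul_comm]; exact hab, by omega⟩, ?_⟩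
      have h1 : (a % 3) * (b % 3) % 3 = 2 := by
        rw [← Nat.mul_mod]
        dsimp only at hab
        omega
      have h2 : a % 3 < 3 := Nat.mod_lt _ (by norm_num)
      have h3 : b % 3 < 3 := Nat.mod_lt _ (by norm_num)
      dsimp only [Prod.swap] at ha ⊢
      generalize a % 3 = k at *
      generalize b % 3 = l at *
      interval_cases k <;> interval_cases l <;> omega
  rw [Finset.sum_add_distrib, hswap, Finset.sum_filter_add_sum_filter_not,
    Nat.sum_divisorsAntidiagonal (fun a _ => (a : ℂ))]

theorem sum_filter_sub_eq_sum_jacobiSym (n : ℕ) :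
    (∑ x ∈ (3 * n + 1).divisorsAntidiagonal with x.1 % 3 = 1, (1 : ℂ)) -
      ∑ x ∈ (3 * n + 1).divisorsAntidiagonal with x.1 % 3 = 2, (1 : ℂ) =
      ∑ d ∈ (3 * n + 1).divisors, (jacobiSym (d : ℤ) 3 : ℂ) := by
  rw [← Nat.sum_divisorsAntidiagonal (fun a _ => (jacobiSym (a : ℤ) 3 : ℂ)), Finset.sum_filter,
    Finset.sum_filter, ← Finset.sum_sub_distrib]
  refine Finset.sum_congr rfl fun x hx => ?_
  have hx1 := (Nat.mem_divisorsAntidiagonal.1 hx).1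
  rcases (show x.1 % 3 = 0 ∨ x.1 % 3 = 1 ∨ x.1 % 3 = 2 by omega) with h | h | h
  · exfalso
    have h1 := Nat.mul_mod x.1 x.2 3
    rw [hx1, h, zero_mul] at h1
    omega
  · simp [h, jacobiSym_three_of_mod_eq_one h]
  · simp [h, jacobiSym_three_of_mod_eq_two h]

/-! ### The product form of the bilateral series -/

theorem tendsto_qPochhammer (a : ℂ) {q : ℂ} (hq : ‖q‖ < 1) :
    Tendsto (qPochhammer a q) atTop (𝓝 (qPochhammerInf a q)) :=
  (multipliable_qPochhammerInf a hq).tendsto_prod_tprod_nat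

theorem qPochhammer_three_mul (q : ℂ) (n : ℕ) :
    qPochhammer q q (3 * n) =
      qPochhammer q (q ^ 3) n * qPochhammer (q ^ 2) (q ^ 3) n * qPochhammer (q ^ 3) (q ^ 3) n := by
  induction n with
  | zero => simp [qPochhammer]
  | succ n ih =>
    rw [mul_add_one, qPochhammer_succ, qPochhammer_succ, qPochhammer_succ, ih, qPochhammer_succ,
      qPochhammer_succ, qPochhammer_succ]
    ring

theorem qPochhammerInf_self_eq_mul_cube {q : ℂ} (hq : ‖q‖ < 1) :
    qPochhammerInf q q = qPochhammerInf q (q ^ 3) * qPochhammerInf (q ^ 2) (q ^ 3) *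
      qPochhammerInf (q ^ 3) (q ^ 3) := by
  have h3 : ‖q ^ 3‖ < 1 := norm_pow_succ_lt_one hq 2
  have h1 := (tendsto_qPochhammer q hq).comp (tendsto_id.const_mul_atTop' (show 0 < 3 by norm_num))
  refine tendsto_nhds_unique h1 ?_
  refine (((tendsto_qPochhammer q h3).mul (tendsto_qPochhammer (q ^ 2) h3)).mul
    (tendsto_qPochhammer (q ^ 3) h3)).congr fun n => ?_
  exact (qPochhammer_three_mul q n).symm

/-- The limit of the finite partial fraction expansions, by dominated convergence. -/
theorem tsum_int_pow_div_eq {q : ℂ} (hq : ‖q‖ < 1) (hq0 : q ≠ 0) :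
    ∑' n : ℤ, q ^ n / (1 - q ^ (3 * n + 1)) =
      qPochhammerInf (q ^ 3) (q ^ 3) ^ 3 / qPochhammerInf q q := by
  have h3 : ‖q ^ 3‖ < 1 := norm_pow_succ_lt_one hq 2
  have hP := qPochhammerInf_self_ne_zero h3
  set g : ℤ → ℂ := fun n => q ^ n / (1 - q ^ (3 * n + 1)) with hgdef
  have hg : Summable g := (hasSum_int_pow_div hq hq0).summable
  set r : ℕ → ℂ := fun k => qPochhammer q (q ^ 3) k / qPochhammer (q ^ 3) (q ^ 3) k
  set s : ℕ → ℂ := fun k => qPochhammer (q ^ 2) (q ^ 3) k / qPochhammer (q ^ 3) (q ^ 3) k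
  set R := qPochhammerInf q (q ^ 3) / qPochhammerInf (q ^ 3) (q ^ 3) with hR
  set S := qPochhammerInf (q ^ 2) (q ^ 3) / qPochhammerInf (q ^ 3) (q ^ 3) with hS
  have hr : Tendsto r atTop (𝓝 R) :=
    (tendsto_qPochhammer q h3).div (tendsto_qPochhammer (q ^ 3) h3) hP
  have hs : Tendsto s atTop (𝓝 S) :=
    (tendsto_qPochhammer (q ^ 2) h3).div (tendsto_qPochhammer (q ^ 3) h3) hP
  obtain ⟨C, hC⟩ := (Metric.isBounded_range_of_tendsto r hr).exists_norm_le
  obtain ⟨D, hD⟩ := (Metric.isBounded_range_of_tendsto s hs).exists_norm_le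
  have hC' : ∀ k, ‖r k‖ ≤ C := fun k => hC _ ⟨k, rfl⟩
  have hD' : ∀ k, ‖s k‖ ≤ D := fun k => hD _ ⟨k, rfl⟩
  have hC0 : 0 ≤ C := (norm_nonneg _).trans (hC' 0)
  have hD0 : 0 ≤ D := (norm_nonneg _).trans (hD' 0)
  -- The `N`-th finite expansion, extended by zero to a sum over `ℤ`.
  let F : ℕ → ℤ → ℂ := fun N n =>
    if n ∈ Finset.Icc (-(N : ℤ)) N then g n * r (N - n).toNat * s (N + n).toNat else 0
  have hF : ∀ N, ∑' n, F N n = 1 / (1 - q ^ (3 * N + 1)) := by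
    intro N
    rw [tsum_eq_sum (s := Finset.Icc (-(N : ℤ)) N) (fun n hn => if_neg hn),
      ← sum_range_div_eq hq0 (pow_succ_ne_one hq) N]
    refine Finset.sum_nbij' (fun n => (N + n).toNat) (fun m => (m : ℤ) - N) ?_ ?_ ?_ ?_ ?_
    · intro n hn
      rw [Finset.mem_Icc] at hn
      rw [Finset.mem_range]
      omega
    · intro m hm
      rw [Finset.mem_range] at hm
      rw [Finset.mem_Icc]
      omega
    · intro n hn
      rw [Finset.mem_Icc] at hn
      omega
    · intro m hm
      omega
    · intro n hn
      have hn' := Finset.mem_Icc.1 hn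
      have e1 : (((N + n).toNat : ℕ) : ℤ) - N = n := by omega
      have e2 : 2 * N - (N + n).toNat = (N - n).toNat := by omega
      rw [e1, e2]
      exact if_pos hn
  have hlim := tendsto_tsum_of_dominated_convergence (f := F) (𝓕 := atTop)
    (g := fun n => g n * R * S) (hg.norm.mul_right (C * D))
    (fun n => by
      have t1 : Tendsto (fun N : ℕ => ((N : ℤ) - n).toNat) atTop atTop :=
        tendsto_atTop.2 fun b => eventually_atTop.2 ⟨(b + n).toNat, fun N hN => by omega⟩
      have t2 : Tendsto (fun N : ℕ => ((N : ℤ) + n).toNat) atTop atTop :=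
        tendsto_atTop.2 fun b => eventually_atTop.2 ⟨(b - n).toNat, fun N hN => by omega⟩
      refine (((hr.comp t1).const_mul (g n)).mul (hs.comp t2)).congr' ?_
      filter_upwards [eventually_ge_atTop n.natAbs] with N hN
      exact (if_pos (Finset.mem_Icc.2 (by omega))).symm)
    (Eventually.of_forall fun N n => by
      by_cases hn : n ∈ Finset.Icc (-(N : ℤ)) N
      · simp only [F, if_pos hn]
        rw [mul_assoc, norm_mul, norm_mul]
        exact mul_le_mul_of_nonneg_left
          (mul_le_mul (hC' _) (hD' _) (norm_nonneg _) hC0) (norm_nonneg _)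
      · simp only [F, if_neg hn, norm_zero]
        positivity)
  simp only [hF] at hlim
  have hone : Tendsto (fun N : ℕ => 1 / (1 - q ^ (3 * N + 1))) atTop (𝓝 1) := by
    have t : Tendsto (fun N : ℕ => 3 * N + 1) atTop atTop :=
      tendsto_atTop_mono (fun N => (by omega : N ≤ 3 * N + 1)) tendsto_id
    have h := (tendsto_pow_atTop_nhds_zero_of_norm_lt_one hq).comp t
    have := (tendsto_const_nhds (x := (1 : ℂ))).div
      ((tendsto_const_nhds (x := (1 : ℂ))).sub h) (by simp)
    simpa [Pi.div_def] using this
  have h := tendsto_nhds_unique hlim hone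
  rw [tsum_mul_right, tsum_mul_right] at h
  have hne := qPochhammerInf_self_ne_zero hq
  have hprod := qPochhammerInf_self_eq_mul_cube hq
  rw [eq_div_iff hne, hprod]
  -- `h` reads `(∑ g) * R * S = 1`.
  have h' : (∑' n, g n) * (qPochhammerInf q (q ^ 3) * qPochhammerInf (q ^ 2) (q ^ 3)) =
      qPochhammerInf (q ^ 3) (q ^ 3) ^ 2 := by
    rw [hR, hS] at h
    field_simp at h
    linear_combination h
  linear_combination qPochhammerInf (q ^ 3) (q ^ 3) * h'

/-! ### The generating functions -/

theorem hasSum_sum_divisors {q : ℂ} (hq : ‖q‖ < 1) (hq0 : q ≠ 0) :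
    HasSum (fun n : ℕ => (∑ d ∈ (3 * n + 2).divisors, (d : ℂ)) * q ^ n)
      (3 * qPochhammerInf (q ^ 3) (q ^ 3) ^ 6 / qPochhammerInf q q ^ 2) := by
  have hs : Summable fun p : ℕ × ℕ =>
      ((p.1 : ℂ) + p.2 + 1) * q ^ (3 * p.1 * p.2 + 2 * p.1 + p.2) :=
    summable_natProd_mul_pow hq (w := fun p => (p.1 : ℂ) + p.2 + 1) (fun p => by
      have e : ((p.1 : ℂ) + p.2 + 1) = ((p.1 + p.2 + 1 : ℕ) : ℂ) := by push_cast; ring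
      rw [e, Complex.norm_natCast]
      push_cast
      nlinarith [mul_nonneg (p.1.cast_nonneg (α := ℝ)) (p.2.cast_nonneg (α := ℝ))])
      (e := fun p => 3 * p.1 * p.2 + 2 * p.1 + p.2) (fun p => by omega)
  have hval : 3 * ∑' p : ℕ × ℕ, ((p.1 : ℂ) + p.2 + 1) * q ^ (3 * p.1 * p.2 + 2 * p.1 + p.2) =
      3 * qPochhammerInf (q ^ 3) (q ^ 3) ^ 6 / qPochhammerInf q q ^ 2 := by
    rw [← (hasSum_int_sq_pow_div_sq hq hq0).tsum_eq, ← sq_tsum_int_pow_div hq hq0,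
      tsum_int_pow_div_eq hq hq0, div_pow]
    ring
  rw [← hval]
  have h : HasSum (fun p : ℕ × ℕ => (((3 * p.1 + 1 : ℕ) : ℂ) + ((3 * p.2 + 2 : ℕ) : ℂ)) *
      q ^ (3 * p.1 * p.2 + 2 * p.1 + 1 * p.2 + 0))
      (3 * ∑' p : ℕ × ℕ, ((p.1 : ℂ) + p.2 + 1) * q ^ (3 * p.1 * p.2 + 2 * p.1 + p.2)) := by
    refine hasSum_of_eq (hs.hasSum.mul_left 3) (fun p => ?_) rfl
    push_cast
    rw [one_mul, add_zero]
    ring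
  have h2 := h.divisorsAntidiagonal_of_prod (i := 1) (j := 2) (r := 2) (c := 0)
    (f := fun a b => (a : ℂ) + b) (by norm_num) (by norm_num) (by norm_num) (by norm_num)
    (by norm_num) (by norm_num)
  simpa only [sum_filter_add_eq_sum_divisors] using h2

theorem hasSum_sum_jacobiSym {q : ℂ} (hq : ‖q‖ < 1) (hq0 : q ≠ 0) :
    HasSum (fun n : ℕ => (∑ d ∈ (3 * n + 1).divisors, (jacobiSym (d : ℤ) 3 : ℂ)) * q ^ n)
      (qPochhammerInf (q ^ 3) (q ^ 3) ^ 3 / qPochhammerInf q q) := by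
  have s1 : Summable fun p : ℕ × ℕ => 1 * q ^ (3 * p.1 * p.2 + 1 * p.1 + 1 * p.2 + 0) :=
    summable_natProd_mul_pow hq (w := fun _ => 1) (fun p => by
      simp only [norm_one]; nlinarith [p.1.cast_nonneg (α := ℝ), p.2.cast_nonneg (α := ℝ)])
      (e := fun p => 3 * p.1 * p.2 + 1 * p.1 + 1 * p.2 + 0) (fun p => by omega)
  have s2 : Summable fun p : ℕ × ℕ => 1 * q ^ (3 * p.1 * p.2 + 2 * p.1 + 2 * p.2 + 1) :=
    summable_natProd_mul_pow hq (w := fun _ => 1) (fun p => by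
      simp only [norm_one]; nlinarith [p.1.cast_nonneg (α := ℝ), p.2.cast_nonneg (α := ℝ)])
      (e := fun p => 3 * p.1 * p.2 + 2 * p.1 + 2 * p.2 + 1) (fun p => by omega)
  have h1 := s1.hasSum.divisorsAntidiagonal_of_prod (i := 1) (j := 1) (r := 1) (c := 0)
    (f := fun _ _ => 1) (by norm_num) (by norm_num) (by norm_num) (by norm_num)
    (by norm_num) (by norm_num)
  have h2 := s2.hasSum.divisorsAntidiagonal_of_prod (i := 2) (j := 2) (r := 1) (c := 1)
    (f := fun _ _ => 1) (by norm_num) (by norm_num) (by norm_num) (by norm_num)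
    (by norm_num) (by norm_num)
  have h := h1.sub h2
  rw [← tsum_int_pow_div_eq hq hq0, (hasSum_int_pow_div hq hq0).tsum_eq]
  simpa only [← sub_mul, sum_filter_sub_eq_sum_jacobiSym, one_mul, add_zero] using h

theorem qPochhammerInf_zero_left (q : ℂ) : qPochhammerInf 0 q = 1 := by
  simp [qPochhammerInf]

theorem hasSum_mul_zero_pow (a : ℕ → ℂ) : HasSum (fun n => a n * 0 ^ n) (a 0) := by
  have h := hasSum_single (f := fun n => a n * (0 : ℂ) ^ n) 0 fun n hn => by simp [hn]
  simpa using h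

theorem mainTheorem1 :
    (∀ q : ℂ, ‖q‖ < 1 →
      HasSum (fun n : ℕ => (∑ d ∈ (3 * n + 2).divisors, (d : ℂ)) * q ^ n)
        (3 * qPochhammerInf (q ^ 3) (q ^ 3) ^ 6 / qPochhammerInf q q ^ 2)) ∧
    (∀ q : ℂ, ‖q‖ < 1 →
      HasSum (fun n : ℕ => (∑ d ∈ (3 * n + 1).divisors, (jacobiSym (d : ℤ) 3 : ℂ)) * q ^ n)
        (qPochhammerInf (q ^ 3) (q ^ 3) ^ 3 / qPochhammerInf q q)) ∧
    (∀ q : ℂ, ‖q‖ < 1 →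
      HasSum (fun n : ℕ => (∑ d ∈ (3 * n + 2).divisors, (jacobiSym (d : ℤ) 3 : ℂ)) * q ^ n) 0) ∧
    (∀ n : ℕ, ∑ d ∈ (3 * n + 2).divisors, jacobiSym (d : ℤ) 3 = 0) := by
  refine ⟨fun q hq => ?_, fun q hq => ?_, fun q _ => ?_, sum_divisors_jacobiSym_three_eq_zero⟩
  -- At `q = 0` the negative powers in the bilateral series are junk, so the value is computed.
  · rcases eq_or_ne q 0 with rfl | hq0
    · convert hasSum_mul_zero_pow _ using 1
      have h2 : Nat.divisors (3 * 0 + 2) = {1, 2} := by decide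
      rw [h2, zero_pow three_ne_zero, qPochhammerInf_zero_left]
      norm_num
    · exact hasSum_sum_divisors hq hq0
  · rcases eq_or_ne q 0 with rfl | hq0
    · convert hasSum_mul_zero_pow _ using 1
      rw [zero_pow three_ne_zero, qPochhammerInf_zero_left]
      simp
    · exact hasSum_sum_jacobiSym hq hq0
  · have h : ∀ n : ℕ, ∑ d ∈ (3 * n + 2).divisors, (jacobiSym (d : ℤ) 3 : ℂ) = 0 := fun n => by
      exact_mod_cast sum_divisors_jacobiSym_three_eq_zero n
    simp only [h, zero_mul]
    exact hasSum_zero
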